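/- Let $m\ge 1$ be an integer and let $\delta>-m$ be real. For $\varepsilon>-1$ let $G_1^{1,\varepsilon}$ be the directed multigraph with the single vertex $1$ and a single loop. For $k\ge 2$, let $G_k^{1,\varepsilon}$ be obtained from $G_{k-1}^{1,\varepsilon}$ by adding a vertex $k$ together with one edge directed out of $k$ and into a random vertex of $\{1,\dots,k\}$, which is chosen, given $G_{k-1}^{1,\varepsilon}$, with probability proportional to its total degree (in-degree plus out-degree) plus $\varepsilon$; here vertex $k$ initially has degree one, so that it connects to itself with probability $(1+\varepsilon)/(k(2+\varepsilon)-1)$. For $n\ge 1$ the linear preferential attachment graph $G_n^{m,\delta}$ with $n$ vertices is obtained from $G_{nm}^{1,\delta/m}$ by identifying consecutive vertices in groups of size $m$, starting from the first vertex, and retaining all edges (loops and multiple edges included). A loop contributes one to the in-degree and one to the out-degree of its vertex. Let $W_n$ be the in-degree of a vertex of $G_n^{m,\delta}$ chosen uniformly at random, independently of the graph. For $r>0$ and $0<p\le 1$ let $\mathrm{NB}(r,p)$ be the distribution on $\{0,1,2,\dots\}$ with point probabilities $\frac{\Gamma(r+k)}{k!\,\Gamma(r)}(1-p)^kp^r$,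 and let $\mathrm{K}(m,\delta)$ be the mixture $\mathrm{NB}(m+\delta,U^{1/(2+\delta/m)})$, where $U$ is uniform on $(0,1)$. For probability distributions $\mu,\nu$ on $\{0,1,2,\dots\}$ let $d_{\mathrm{TV}}(\mu,\nu)=\sup_{A\subseteq\{0,1,2,\dots\}}|\mu(A)-\nu(A)|$. Then there is a constant $C_{m,\delta}$, depending only on $m$ and $\delta$, such that for all $n\ge 2$ $$d_{\mathrm{TV}}\bigl(\mathscr{L}(W_n),\mathrm{K}(m,\delta)\bigr)\le C_{m,\delta}\,\frac{\log n}{n}.$$ -/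

import Mathlib

open MeasureTheory

noncomputable section

namespace PrefAttach

/-- A finite directed multigraph on the vertex set `V` (loops and multiple edges allowed):
a multiset of directed edges, where `(u, v)` is an edge going out of `u` and into `v`. -/
structure DiMultigraph (V : Type) where
  edges : Multiset (V × V)

namespace DiMultigraph

variable {V V' : Type}

/-- The number of edges (with multiplicity) going into `v`. A loop at `v` counts once. -/
def inDegree [DecidableEq V] (G : DiMultigraph V) (v : V) : ℕ :=
  (G.edges.map Prod.snd).count v

/-- The number of edges (with multiplicity) going out of `v`. A loop at `v` counts once. -/
def outDegree [DecidableEq V] (G : DiMultigraph V) (v : V) : ℕ :=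
  (G.edges.map Prod.fst).count v

/-- The total degree. A loop at `v` counts twice. -/
def degree [DecidableEq V] (G : DiMultigraph V) (v : V) : ℕ :=
  G.inDegree v + G.outDegree v

/-- Relabel (and possibly identify) vertices along `f`, retaining all edges. -/
def map (f : V → V') (G : DiMultigraph V) : DiMultigraph V' :=
  ⟨G.edges.map (Prod.map f f)⟩

/-- Add an edge going out of `u` and into `v`. -/
def addEdge (G : DiMultigraph V) (u v : V) : DiMultigraph V :=
  ⟨(u, v) ::ₘ G.edges⟩

/-- Add a new isolated vertex `Fin.last k` to a graph with vertex set `Fin k`. -/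
def addVertex {k : ℕ} (G : DiMultigraph (Fin k)) : DiMultigraph (Fin (k + 1)) :=
  G.map Fin.castSucc

end DiMultigraph

/-- The attachment weight of the vertex `v`, when the vertex `Fin.last k` is being added to the
graph `G` with vertex set `Fin k`: the total degree of `v` plus `ε`, where the new vertex has
initial degree one (from the outgoing end of the edge that is being attached). -/
def weight (ε : ℝ) {k : ℕ} (G : DiMultigraph (Fin k)) (v : Fin (k + 1)) : ℝ :=
  (G.addVertex.degree v : ℝ) + (if v = Fin.last k then 1 else 0) + ε

theorem tsum_weight_ne_zero {ε : ℝ} (hε : -1 < ε) {k : ℕ} (G : DiMultigraph (Fin k)) :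
    ∑' v, ENNReal.ofReal (weight ε G v) ≠ 0 := by
  intro h
  have h1 := ENNReal.tsum_eq_zero.1 h (Fin.last k)
  rw [ENNReal.ofReal_eq_zero] at h1
  have h2 : (0 : ℝ) ≤ (G.addVertex.degree (Fin.last k) : ℝ) := Nat.cast_nonneg _
  simp only [weight, if_true] at h1
  linarith

theorem tsum_weight_ne_top (ε : ℝ) {k : ℕ} (G : DiMultigraph (Fin k)) :
    ∑' v, ENNReal.ofReal (weight ε G v) ≠ ⊤ := by
  rw [tsum_fintype]
  exact ENNReal.sum_ne_top.2 fun _ _ => ENNReal.ofReal_ne_top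

/-- The law of the vertex to which the new vertex attaches: it is chosen with probability
proportional to its weight. -/
def attachLaw {ε : ℝ} (hε : -1 < ε) {k : ℕ} (G : DiMultigraph (Fin k)) : PMF (Fin (k + 1)) :=
  PMF.normalize (fun v => ENNReal.ofReal (weight ε G v))
    (tsum_weight_ne_zero hε G) (tsum_weight_ne_top ε G)

/-- The law of the random graph `G_k^{1,ε}` with vertex set `Fin k` (the vertices `1, …, k` of
the usual description are `0, …, k - 1` here). The recursion starts from the graph without
vertices, from which the first step produces one vertex with a single loop, see `graphOne_one`. -/
def graphOne {ε : ℝ} (hε : -1 < ε) : (k : ℕ) → PMF (DiMultigraph (Fin k))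
  | 0 => PMF.pure ⟨0⟩
  | k + 1 => (graphOne hε k).bind fun G =>
      (attachLaw hε G).map fun v => G.addVertex.addEdge (Fin.last k) v

theorem graphOne_one {ε : ℝ} (hε : -1 < ε) :
    graphOne hε 1 = PMF.pure ⟨{((0 : Fin 1), (0 : Fin 1))}⟩ := by
  have h : attachLaw hε (⟨0⟩ : DiMultigraph (Fin 0)) = PMF.pure (0 : Fin 1) := by
    ext v
    have hs := (attachLaw hε (⟨0⟩ : DiMultigraph (Fin 0))).tsum_coe
    rw [tsum_fintype, Fin.sum_univ_one] at hs
    obtain rfl : v = (0 : Fin 1) := Subsingleton.elim (α := Fin 1) v 0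
    simpa using hs
  simp only [graphOne, PMF.pure_bind]
  rw [h, PMF.pure_map]
  rfl

theorem neg_one_lt_div {m : ℕ} (hm : 1 ≤ m) {δ : ℝ} (hδ : -(m : ℝ) < δ) :
    -1 < δ / (m : ℝ) := by
  have h : (0 : ℝ) < m := by exact_mod_cast hm
  rw [lt_div_iff₀ h]
  linarith

/-- The law of the random graph `G_n^{m,δ}` with vertex set `Fin n`: generate
`G_{nm}^{1,δ/m}` and collapse consecutive vertices into groups of size `m`
(`Fin.divNat` sends `j < n * m` to `j / m < n`), retaining all edges. -/
def graph {m : ℕ} (hm : 1 ≤ m) {δ : ℝ} (hδ : -(m : ℝ) < δ) (n : ℕ) :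
    PMF (DiMultigraph (Fin n)) :=
  (graphOne (neg_one_lt_div hm hδ) (n * m)).map (DiMultigraph.map Fin.divNat)

/-- The law of `W_n`, the in-degree of a uniformly chosen random vertex of `G_n^{m,δ}`
(the vertex being independent of the graph). -/
def inDegreeLaw {m : ℕ} (hm : 1 ≤ m) {δ : ℝ} (hδ : -(m : ℝ) < δ) (n : ℕ) [NeZero n] : PMF ℕ :=
  (graph hm hδ n).bind fun G => (PMF.uniformOfFintype (Fin n)).map G.inDegree

/-- The point probabilities of the negative binomial distribution `NB(r, p)`. -/
def nbProb (r p : ℝ) (k : ℕ) : ℝ :=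
  Real.Gamma (r + k) / (k.factorial * Real.Gamma r) * (1 - p) ^ k * p ^ r

/-- The negative binomial distribution `NB(r, p)` (for `0 < r` and `0 < p ≤ 1`). -/
def NB (r p : ℝ) : Measure ℕ :=
  Measure.count.withDensity fun k => ENNReal.ofReal (nbProb r p k)

/-- The mixed negative binomial distribution `K(m, δ) = NB(m + δ, U ^ (1 / (2 + δ / m)))`, where
`U` is uniform on `(0, 1)`. -/
def K (m : ℕ) (δ : ℝ) : Measure ℕ :=
  (volume.restrict (Set.Ioo (0 : ℝ) 1)).bind fun u =>
    NB ((m : ℝ) + δ) (u ^ (1 / (2 + δ / (m : ℝ))))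

/-- The total variation distance between two probability distributions on `ℕ`. -/
def dTV (μ ν : Measure ℕ) : ℝ :=
  ⨆ A : Set ℕ, |μ.real A - ν.real A|

end PrefAttach

end

/-!
Write `ε = δ / m`, `a = 2 + ε` and `r = m + δ = m (1 + ε)`. When vertex `t + 1` is added to
`G_t^{1,ε}`, the total attachment weight is `c_t = a (t + 1) - 1`, and a complete block of `m`
consecutive vertices with in-degree `x` is hit with probability `(x + r) / c_t`, whatever the rest
of the graph looks like. So the in-degree of a block is a time-inhomogeneous pure birth chain
(`blockProb_succ`), and the law of `W_n` is the average over the blocks of the laws of these chains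
at time `n * m` (`toReal_inDegreeLaw`).

The point probabilities `p_k` of `K(m, δ)` satisfy `p_0 = a / (a + r)` and
`(a + r + k + 1) p_{k+1} = (r + k) p_k`, by an integration by parts (`mixProb_succ`). Equivalently,
if `A` is the generator which moves mass from `k` to `k + 1` at rate `k + r`, then
`p A = a (p - δ_0)` (`birthStep_mixProb`). Also `p_k = O(k ^ (-2))`, since `a > 1`.

Let `N_t` be the vector of expected numbers of blocks of each in-degree, and compare it with
`T_t = (t / m) p + β_t δ_0`, where `β_t ∈ [0, 1]` accounts for the block under construction. By the
identity for `p A`, both follow the recursion with transition matrix `I + A / c_t` up to an error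
of `ℓ¹`-norm `O(1 / t)` (`deviation_succ`, `sum_abs_drift_le`). On the states `x ≤ t` the matrix
`I + A / c_t` is stochastic for `t ≥ m`, hence an `ℓ¹`-contraction (`sum_abs_birthStep_le`),
and the mass of `T_t` beyond `t` contributes only `O(1 / t)` more (`abs_deviation_boundary_le`). Summing up, `N_t`
and `T_t` differ by `O(log t)` in `ℓ¹` (`deviationNorm_le`). At time `t = n * m` division by `n`
gives the bound `O(log n / n)` for the total variation distance.
-/

namespace PrefAttach

open scoped ENNReal

/-! ### Attachment to a block of vertices -/

/-- The in-degree of the block `{i * m, …, i * m + m - 1}` of vertices: the number of edges going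
into one of its vertices. It is the in-degree of the vertex `i` after collapsing. -/
def blockInDegree (m : ℕ) {k : ℕ} (i : ℕ) (G : DiMultigraph (Fin k)) : ℕ :=
  (G.edges.map fun e => (e.2 : ℕ) / m).count i

theorem inDegree_map_divNat {m n : ℕ} (G : DiMultigraph (Fin (n * m))) (i : Fin n) :
    (G.map Fin.divNat).inDegree i = blockInDegree m i G := by
  unfold DiMultigraph.inDegree DiMultigraph.map blockInDegree
  rw [← Multiset.count_map_eq_count' Fin.val _ Fin.val_injective]
  simp [Multiset.map_map, Function.comp_def]

theorem blockInDegree_addEdge (m i : ℕ) {k : ℕ} (G : DiMultigraph (Fin k)) (v : Fin (k + 1)) :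
    blockInDegree m i (G.addVertex.addEdge (Fin.last k) v) =
      blockInDegree m i G + if (v : ℕ) / m = i then 1 else 0 := by
  simp [DiMultigraph.addEdge, DiMultigraph.addVertex, DiMultigraph.map, blockInDegree,
    Multiset.count_cons, eq_comm]

/-- Every vertex of `G_k^{1,ε}` has out-degree one. -/
theorem map_fst_of_mem_support {ε : ℝ} (hε : -1 < ε) (k : ℕ) :
    ∀ G ∈ (graphOne hε k).support, G.edges.map Prod.fst = (Finset.univ : Finset (Fin k)).val := by
  induction k with
  | zero =>
    intro G hG
    simp only [graphOne, PMF.support_pure, Set.mem_singleton_iff] at hG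
    subst hG
    rfl
  | succ k ih =>
    intro G hG
    simp only [graphOne, PMF.mem_support_bind_iff, PMF.mem_support_map_iff] at hG
    obtain ⟨H, hH, v, -, rfl⟩ := hG
    have h := congrArg (Multiset.map Fin.castSucc) (ih H hH)
    rw [Multiset.map_map] at h
    rw [Fin.univ_castSuccEmb]
    simp only [DiMultigraph.addEdge, DiMultigraph.addVertex, DiMultigraph.map,
      Multiset.map_cons, Multiset.map_map, Finset.cons_val, Finset.map_val]
    congr 1

theorem sum_count_filter {α : Type*} [Fintype α] [DecidableEq α] (s : Multiset α) (P : α → Prop)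
    [DecidablePred P] : ∑ v with P v, s.count v = s.countP P := by
  induction s using Multiset.induction_on with
  | empty => simp
  | cons a s ih =>
    simp only [Multiset.count_cons, Multiset.countP_cons, Finset.sum_add_distrib, ih]
    congr 1
    simp [Finset.sum_ite_eq']

/-- Since every vertex has out-degree one, the attachment weight depends on the in-degree only. -/
theorem weight_eq {ε : ℝ} {k : ℕ} {G : DiMultigraph (Fin k)}
    (hG : G.edges.map Prod.fst = (Finset.univ : Finset (Fin k)).val) (v : Fin (k + 1)) :
    weight ε G v = G.addVertex.inDegree v + (1 + ε) := by
  have h : (G.addVertex.outDegree v : ℝ) + (if v = Fin.last k then 1 else 0) = 1 := by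
    have h1 := congrArg (Multiset.map Fin.castSucc) hG
    rw [Multiset.map_map] at h1
    have h2 : G.addVertex.edges.map Prod.fst =
        (Finset.univ.map Fin.castSuccEmb : Finset (Fin (k + 1))).val := by
      simp only [DiMultigraph.addVertex, DiMultigraph.map, Multiset.map_map, Finset.map_val]
      exact h1
    unfold DiMultigraph.outDegree
    rw [h2]
    induction v using Fin.lastCases with
    | last =>
      rw [Multiset.count_eq_zero_of_notMem]
      · simp
      · simp [Fin.castSucc_ne_last]
    | cast v =>
      rw [Multiset.count_eq_one_of_mem (Finset.nodup _)]
      · simp [Fin.castSucc_ne_last]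
      · simp
  unfold weight DiMultigraph.degree
  push_cast
  linarith

/-- The number of vertices among the first `k + 1` that lie in block `i`. -/
def blockSize (m i k : ℕ) : ℕ := (Finset.univ.filter fun v : Fin (k + 1) => (v : ℕ) / m = i).card

theorem sum_weight_block {ε : ℝ} {k : ℕ} (m i : ℕ) {G : DiMultigraph (Fin k)}
    (hG : G.edges.map Prod.fst = (Finset.univ : Finset (Fin k)).val) :
    ∑ v ∈ Finset.univ.filter (fun v : Fin (k + 1) => (v : ℕ) / m = i), weight ε G v =
      blockInDegree m i G + (1 + ε) * blockSize m i k := by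
  rw [Finset.sum_congr rfl fun v _ => weight_eq hG v, Finset.sum_add_distrib, Finset.sum_const,
    nsmul_eq_mul, blockSize, mul_comm (1 + ε)]
  congr 1
  rw [← Nat.cast_sum]
  unfold DiMultigraph.inDegree
  rw [sum_count_filter, blockInDegree, Multiset.count, Multiset.countP_map, Multiset.countP_map]
  simp only [DiMultigraph.addVertex, DiMultigraph.map, Multiset.filter_map, Multiset.card_map]
  simp [eq_comm]

/-- The total attachment weight when vertex `k + 1` is added. -/
noncomputable def totalWeight (ε : ℝ) (k : ℕ) : ℝ := (2 + ε) * (k + 1) - 1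

theorem totalWeight_eq (ε : ℝ) (k : ℕ) : totalWeight ε k = k + (1 + ε) * (k + 1) := by
  unfold totalWeight; ring

theorem totalWeight_pos {ε : ℝ} (hε : -1 < ε) (k : ℕ) : 0 < totalWeight ε k := by
  rw [totalWeight_eq]
  have : 0 < 1 + ε := by linarith
  positivity

theorem sum_weight {ε : ℝ} {k : ℕ} {G : DiMultigraph (Fin k)}
    (hG : G.edges.map Prod.fst = (Finset.univ : Finset (Fin k)).val) :
    ∑ v, weight ε G v = totalWeight ε k := by
  have hc : G.edges.card = k := by simpa using congrArg Multiset.card hG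
  simp only [weight_eq hG, Finset.sum_add_distrib, totalWeight_eq]
  rw [← Nat.cast_sum]
  unfold DiMultigraph.inDegree
  rw [Multiset.sum_count_eq_card (by simp)]
  simp only [DiMultigraph.addVertex, DiMultigraph.map, Multiset.card_map, hc, Finset.sum_const,
    Finset.card_univ, Fintype.card_fin, nsmul_eq_mul]
  push_cast
  ring

theorem attachLaw_apply {ε : ℝ} (hε : -1 < ε) {k : ℕ} {G : DiMultigraph (Fin k)}
    (hG : G.edges.map Prod.fst = (Finset.univ : Finset (Fin k)).val) (v : Fin (k + 1)) :
    attachLaw hε G v = ENNReal.ofReal (weight ε G v / totalWeight ε k) := by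
  have h0 : ∀ v ∈ Finset.univ, 0 ≤ weight ε G v := fun v _ => by
    rw [weight_eq hG]
    have : 0 < 1 + ε := by linarith
    positivity
  rw [attachLaw, PMF.normalize_apply, tsum_fintype, ← ENNReal.ofReal_sum_of_nonneg h0,
    sum_weight hG, ENNReal.ofReal_div_of_pos (totalWeight_pos hε k), div_eq_mul_inv]

/-! ### The in-degree of a block as a pure birth chain -/

/-- The law of the in-degree of block `i` in `G_k^{1,ε}`. -/
noncomputable def blockLaw {ε : ℝ} (hε : -1 < ε) (m i k : ℕ) : PMF ℕ :=
  (graphOne hε k).map (blockInDegree m i)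

/-- The probability that the edge out of vertex `k + 1` goes into block `i` if this block has
in-degree `x`. -/
noncomputable def blockRate (ε : ℝ) (m i k x : ℕ) : ℝ :=
  (x + (1 + ε) * blockSize m i k) / totalWeight ε k

theorem sum_attachLaw_block {ε : ℝ} (hε : -1 < ε) {k : ℕ} (m i : ℕ) {G : DiMultigraph (Fin k)}
    (hG : G.edges.map Prod.fst = (Finset.univ : Finset (Fin k)).val) :
    ∑ v ∈ Finset.univ.filter (fun v : Fin (k + 1) => (v : ℕ) / m = i), attachLaw hε G v =
      ENNReal.ofReal (blockRate ε m i k (blockInDegree m i G)) := by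
  have h0 : ∀ v : Fin (k + 1), 0 ≤ weight ε G v / totalWeight ε k := fun v => by
    rw [weight_eq hG]
    have : 0 < 1 + ε := by linarith
    have := totalWeight_pos hε k
    positivity
  simp only [attachLaw_apply hε hG]
  rw [← ENNReal.ofReal_sum_of_nonneg fun v _ => h0 v, ← Finset.sum_div, sum_weight_block m i hG,
    blockRate]

theorem sum_attachLaw_not_block {ε : ℝ} (hε : -1 < ε) {k : ℕ} (m i : ℕ)
    {G : DiMultigraph (Fin k)}
    (hG : G.edges.map Prod.fst = (Finset.univ : Finset (Fin k)).val) :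
    ∑ v ∈ Finset.univ.filter (fun v : Fin (k + 1) => ¬ (v : ℕ) / m = i), attachLaw hε G v =
      ENNReal.ofReal (1 - blockRate ε m i k (blockInDegree m i G)) := by
  have h := sum_attachLaw_block hε m i hG
  have h1 := (attachLaw hε G).tsum_coe
  rw [tsum_fintype,
    ← Finset.sum_filter_add_sum_filter_not _ (fun v : Fin (k + 1) => (v : ℕ) / m = i), h] at h1
  have hr : 0 ≤ blockRate ε m i k (blockInDegree m i G) := by
    have : 0 < 1 + ε := by linarith
    have := totalWeight_pos hε k
    unfold blockRate
    positivity
  rw [ENNReal.ofReal_sub _ hr, ENNReal.ofReal_one, ← h1, ENNReal.add_sub_cancel_left]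
  exact ENNReal.ofReal_ne_top

theorem tsum_map_mul {α β : Type*} (p : PMF α) (f : α → β) (h : β → ℝ≥0∞) :
    ∑' b, p.map f b * h b = ∑' a, p a * h (f a) := by
  simp only [PMF.map_apply, ← ENNReal.tsum_mul_right]
  rw [ENNReal.tsum_comm]
  refine tsum_congr fun a => ?_
  rw [tsum_eq_single (f a) fun b hb => by simp [hb]]
  simp

/-- The in-degree of a block is a pure birth chain. -/
theorem blockLaw_succ_apply {ε : ℝ} (hε : -1 < ε) (m i k x : ℕ) :
    blockLaw hε m i (k + 1) x =
      ∑' y, blockLaw hε m i k y *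
        ((if x = y + 1 then ENNReal.ofReal (blockRate ε m i k y) else 0) +
          if x = y then ENNReal.ofReal (1 - blockRate ε m i k y) else 0) := by
  rw [blockLaw, blockLaw, tsum_map_mul, graphOne, PMF.map_bind, PMF.bind_apply]
  refine tsum_congr fun G => ?_
  by_cases hG : graphOne hε k G = 0
  · simp [hG]
  have hG' := map_fst_of_mem_support hε k G ((PMF.mem_support_iff _ _).2 hG)
  congr 1
  rw [PMF.map_comp, PMF.map_apply, tsum_fintype, ← sum_attachLaw_block hε m i hG',
    ← sum_attachLaw_not_block hε m i hG',
    ← Finset.sum_filter_add_sum_filter_not _ (fun v : Fin (k + 1) => (v : ℕ) / m = i)]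
  congr 1
  · split_ifs with hx
    · refine Finset.sum_congr rfl fun v hv => ?_
      simp [blockInDegree_addEdge, (Finset.mem_filter.1 hv).2, hx]
    · refine Finset.sum_eq_zero fun v hv => ?_
      simp [blockInDegree_addEdge, (Finset.mem_filter.1 hv).2, hx]
  · split_ifs with hx
    · refine Finset.sum_congr rfl fun v hv => ?_
      simp [blockInDegree_addEdge, (Finset.mem_filter.1 hv).2, hx]
    · refine Finset.sum_eq_zero fun v hv => ?_
      simp [blockInDegree_addEdge, (Finset.mem_filter.1 hv).2, hx]

theorem blockLaw_eq_zero_of_lt {ε : ℝ} (hε : -1 < ε) (m i : ℕ) {k x : ℕ} (hx : k < x) :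
    blockLaw hε m i k x = 0 := by
  rw [PMF.apply_eq_zero_iff, blockLaw, PMF.mem_support_map_iff]
  rintro ⟨G, hG, rfl⟩
  have hc : G.edges.card = k := by
    simpa using congrArg Multiset.card (map_fst_of_mem_support hε k G hG)
  have h : blockInDegree m i G ≤ G.edges.card := by
    unfold blockInDegree
    exact (Multiset.count_le_card _ _).trans (by simp)
  omega

theorem blockLaw_eq_pure {ε : ℝ} (hε : -1 < ε) {m i k : ℕ} (h : k ≤ i * m) :
    blockLaw hε m i k = PMF.pure 0 := by
  have h0 : ∀ G : DiMultigraph (Fin k), blockInDegree m i G = 0 := fun G => by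
    rw [blockInDegree, Multiset.count_eq_zero, Multiset.mem_map]
    rintro ⟨e, -, he⟩
    have h1 := e.2.2
    have h2 := Nat.div_lt_of_lt_mul (h1.trans_le (h.trans (mul_comm i m).le))
    omega
  rw [blockLaw, funext h0]
  exact PMF.map_const _ _

theorem blockSize_le (m i k : ℕ) : blockSize m i k ≤ k + 1 := by
  simpa [blockSize] using
    Finset.card_filter_le (Finset.univ : Finset (Fin (k + 1))) fun v => (v : ℕ) / m = i

theorem blockSize_le_size {m : ℕ} (hm : 1 ≤ m) (i k : ℕ) : blockSize m i k ≤ m := by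
  rw [blockSize, ← Finset.card_map Fin.valEmbedding]
  calc _ ≤ (Finset.Ico (i * m) (i * m + m)).card := by
        refine Finset.card_le_card fun x hx => ?_
        obtain ⟨v, hv, rfl⟩ := Finset.mem_map.1 hx
        have h := (Finset.mem_filter.1 hv).2
        have h1 := (Nat.div_eq_iff (by omega)).1 h
        simp only [Fin.valEmbedding_apply, Finset.mem_Ico]
        omega
    _ = m := by simp

theorem blockSize_eq {m : ℕ} (hm : 1 ≤ m) {i k : ℕ} (h : (i + 1) * m ≤ k) :
    blockSize m i k = m := by
  rw [blockSize, ← Finset.card_map Fin.valEmbedding]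
  calc _ = (Finset.Ico (i * m) (i * m + m)).card := by
        congr 1
        ext x
        simp only [Finset.mem_map, Finset.mem_filter, Finset.mem_univ, true_and,
          Fin.valEmbedding_apply, Finset.mem_Ico]
        have hd := Nat.div_eq_iff (x := x) (k := m) (y := i) (by omega)
        constructor
        · rintro ⟨v, hv, rfl⟩
          have := hd.1 hv
          omega
        · intro hx
          rw [add_mul, one_mul] at h
          exact ⟨⟨x, by omega⟩, hd.2 (by omega), rfl⟩
    _ = m := by simp

/-- One step of the pure birth chain which increases by one with probability `w x` when in state
`x`, acting on (signed) mass functions. -/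
def birthStep (w f : ℕ → ℝ) : ℕ → ℝ
  | 0 => f 0 * (1 - w 0)
  | x + 1 => f (x + 1) * (1 - w (x + 1)) + f x * w x

/-- The probability that block `i` has in-degree `x` in `G_k^{1,ε}`. -/
noncomputable def blockProb {ε : ℝ} (hε : -1 < ε) (m i k x : ℕ) : ℝ := (blockLaw hε m i k x).toReal

theorem blockRate_nonneg {ε : ℝ} (hε : -1 < ε) (m i k x : ℕ) : 0 ≤ blockRate ε m i k x := by
  have : 0 < 1 + ε := by linarith
  have := totalWeight_pos hε k
  unfold blockRate
  positivity

theorem blockRate_le_one {ε : ℝ} (hε : -1 < ε) (m i : ℕ) {k x : ℕ} (hx : x ≤ k) :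
    blockRate ε m i k x ≤ 1 := by
  rw [blockRate, div_le_one (totalWeight_pos hε k), totalWeight_eq]
  have h1 : (blockSize m i k : ℝ) ≤ k + 1 := by exact_mod_cast blockSize_le m i k
  have h2 : (x : ℝ) ≤ k := by exact_mod_cast hx
  have : (1 + ε) * blockSize m i k ≤ (1 + ε) * (k + 1) :=
    mul_le_mul_of_nonneg_left h1 (by linarith)
  linarith

theorem blockProb_succ {ε : ℝ} (hε : -1 < ε) (m i k : ℕ) :
    blockProb hε m i (k + 1) = birthStep (blockRate ε m i k) (blockProb hε m i k) := by
  -- The truncation in `ENNReal.ofReal` is harmless: the chain is at most `k` at time `k`.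
  have key : ∀ y, blockLaw hε m i k y * ENNReal.ofReal (1 - blockRate ε m i k y) =
      ENNReal.ofReal (blockProb hε m i k y * (1 - blockRate ε m i k y)) := fun y => by
    rw [blockProb, ENNReal.ofReal_mul ENNReal.toReal_nonneg,
      ENNReal.ofReal_toReal (PMF.apply_ne_top _ _)]
  have key' : ∀ y, blockLaw hε m i k y * ENNReal.ofReal (blockRate ε m i k y) =
      ENNReal.ofReal (blockProb hε m i k y * blockRate ε m i k y) := fun y => by
    rw [blockProb, ENNReal.ofReal_mul ENNReal.toReal_nonneg,
      ENNReal.ofReal_toReal (PMF.apply_ne_top _ _)]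
  have nn : ∀ y, 0 ≤ blockProb hε m i k y * (1 - blockRate ε m i k y) := fun y => by
    rcases le_or_gt y k with h | h
    · exact mul_nonneg ENNReal.toReal_nonneg (sub_nonneg.2 (blockRate_le_one hε m i h))
    · simp [blockProb, blockLaw_eq_zero_of_lt hε m i h]
  have nn' : ∀ y, 0 ≤ blockProb hε m i k y * blockRate ε m i k y := fun y =>
    mul_nonneg ENNReal.toReal_nonneg (blockRate_nonneg hε m i k y)
  funext x
  rw [blockProb, blockLaw_succ_apply]
  simp only [mul_add, mul_ite, mul_zero, key, key', ENNReal.tsum_add]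
  cases x with
  | zero => simp [birthStep, nn]
  | succ x =>
    rw [tsum_eq_single x fun y hy => by rw [if_neg]; omega, if_pos rfl,
      tsum_eq_single (x + 1) fun y hy => by rw [if_neg]; omega, if_pos rfl,
      ← ENNReal.ofReal_add (nn' _) (nn _), ENNReal.toReal_ofReal (add_nonneg (nn' _) (nn _)),
      birthStep, add_comm]

theorem blockProb_nonneg {ε : ℝ} (hε : -1 < ε) (m i k x : ℕ) : 0 ≤ blockProb hε m i k x :=
  ENNReal.toReal_nonneg

theorem blockProb_eq_zero_of_lt {ε : ℝ} (hε : -1 < ε) (m i : ℕ) {k x : ℕ} (hx : k < x) :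
    blockProb hε m i k x = 0 := by
  simp [blockProb, blockLaw_eq_zero_of_lt hε m i hx]

theorem sum_blockProb_le_one {ε : ℝ} (hε : -1 < ε) (m i k M : ℕ) :
    ∑ x ∈ Finset.range M, blockProb hε m i k x ≤ 1 := by
  unfold blockProb
  rw [← ENNReal.toReal_sum fun x _ => PMF.apply_ne_top _ _]
  refine ENNReal.toReal_le_of_le_ofReal zero_le_one ?_
  rw [ENNReal.ofReal_one, ← (blockLaw hε m i k).tsum_coe]
  exact ENNReal.sum_le_tsum _

/-- The law of `W_n` is the average over the blocks of their in-degree laws. -/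
theorem toReal_inDegreeLaw {m : ℕ} (hm : 1 ≤ m) {δ : ℝ} (hδ : -(m : ℝ) < δ) (n : ℕ) [NeZero n]
    (x : ℕ) :
    (inDegreeLaw hm hδ n x).toReal =
      (∑ i ∈ Finset.range n, blockProb (neg_one_lt_div hm hδ) m i (n * m) x) / n := by
  have h : inDegreeLaw hm hδ n =
      (PMF.uniformOfFintype (Fin n)).bind fun i =>
        blockLaw (neg_one_lt_div hm hδ) m i (n * m) := by
    simp only [inDegreeLaw, graph, blockLaw, PMF.bind_map]
    simp only [← PMF.bind_pure_comp]
    rw [PMF.bind_comm]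
    simp only [Function.comp_def, inDegree_map_divNat]
  rw [h, PMF.bind_apply, tsum_fintype, ENNReal.toReal_sum fun i _ =>
    ENNReal.mul_ne_top (PMF.apply_ne_top _ _) (PMF.apply_ne_top _ _), Finset.sum_range,
    Finset.sum_div]
  refine Finset.sum_congr rfl fun i _ => ?_
  rw [PMF.uniformOfFintype_apply, ENNReal.toReal_mul, blockProb]
  simp [div_eq_inv_mul]

/-! ### The point probabilities of the limit law -/

/-- The integrand in the point probability of the mixture `K`, up to the Gamma factors. -/
noncomputable def mixIntegrand (a r : ℝ) (k : ℕ) (u : ℝ) : ℝ :=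
  (1 - u ^ (1 / a)) ^ k * (u ^ (1 / a)) ^ r

theorem continuous_mixIntegrand {a r : ℝ} (ha : 0 < a) (hr : 0 < r) (k : ℕ) :
    Continuous (mixIntegrand a r k) := by
  have h : Continuous fun u : ℝ => u ^ (1 / a) := Real.continuous_rpow_const (by positivity)
  exact ((continuous_const.sub h).pow k).mul ((Real.continuous_rpow_const hr.le).comp h)

theorem mixIntegrand_nonneg {a r : ℝ} (ha : 0 < a) (k : ℕ) {u : ℝ} (h0 : 0 ≤ u) (h1 : u ≤ 1) :
    0 ≤ mixIntegrand a r k u := by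
  have := Real.rpow_le_one h0 h1 (by positivity : 0 ≤ 1 / a)
  have : 0 ≤ u ^ (1 / a) := Real.rpow_nonneg h0 _
  exact mul_nonneg (pow_nonneg (by linarith) k) (Real.rpow_nonneg this _)

theorem integral_mixIntegrand_zero {a r : ℝ} (ha : 0 < a) (hr : 0 < r) :
    ∫ u in (0 : ℝ)..1, mixIntegrand a r 0 u = a / (a + r) := by
  have h : ∀ u ∈ Set.uIcc (0 : ℝ) 1, mixIntegrand a r 0 u = u ^ (r / a) := fun u hu => by
    rw [Set.uIcc_of_le zero_le_one] at hu
    rw [mixIntegrand, pow_zero, one_mul, ← Real.rpow_mul hu.1, one_div_mul_eq_div]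
  rw [intervalIntegral.integral_congr h, integral_rpow]
  · have : r / a + 1 ≠ 0 := by positivity
    rw [Real.one_rpow, Real.zero_rpow this]
    field_simp
    ring
  · left
    have : 0 < r / a := by positivity
    linarith

/-- Integration by parts, via the primitive `(1 - u ^ (1 / a)) ^ (k + 1) * u ^ (1 + r / a)`. -/
theorem integral_mixIntegrand_succ {a r : ℝ} (ha : 0 < a) (hr : 0 < r) (k : ℕ) :
    (a + r + (k + 1)) * ∫ u in (0 : ℝ)..1, mixIntegrand a r (k + 1) u =
      (k + 1) * ∫ u in (0 : ℝ)..1, mixIntegrand a r k u := by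
  have hint : ∀ k, IntervalIntegrable (mixIntegrand a r k) volume 0 1 := fun k =>
    (continuous_mixIntegrand ha hr k).intervalIntegrable _ _
  have hFTC : ∫ u in (0 : ℝ)..1,
      ((a + r + (k + 1)) * mixIntegrand a r (k + 1) u - (k + 1) * mixIntegrand a r k u) =
      a * (1 * mixIntegrand a r (k + 1) 1) - a * (0 * mixIntegrand a r (k + 1) 0) := by
    refine intervalIntegral.integral_eq_sub_of_hasDerivAt_of_le zero_le_one
      (f := fun u => a * (u * mixIntegrand a r (k + 1) u)) ?_ ?_ ?_
    · have := continuous_mixIntegrand ha hr (k + 1)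
      fun_prop
    · intro u hu
      have hu0 : 0 < u := hu.1
      have hs : 0 < u ^ (1 / a) := Real.rpow_pos_of_pos hu0 _
      have h1 : HasDerivAt (fun u : ℝ => u ^ (1 / a)) (1 / a * u ^ (1 / a - 1)) u :=
        Real.hasDerivAt_rpow_const (Or.inl hu0.ne')
      have h2 := ((h1.const_sub 1).pow (k + 1)).mul (h1.rpow_const (p := r) (Or.inl hs.ne'))
      have h3 := ((hasDerivAt_id u).mul h2).const_mul a
      refine h3.congr_deriv ?_
      simp only [mixIntegrand, Pi.pow_apply, Pi.mul_apply, id]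
      rw [Real.rpow_sub_one hu0.ne', Real.rpow_sub_one hs.ne']
      set s := u ^ (1 / a)
      push_cast
      field_simp
      ring
    · exact ((hint _).const_mul _).sub ((hint _).const_mul _)
  rw [intervalIntegral.integral_sub ((hint _).const_mul _) ((hint _).const_mul _),
    intervalIntegral.integral_const_mul, intervalIntegral.integral_const_mul] at hFTC
  have h1 : mixIntegrand a r (k + 1) 1 = 0 := by simp [mixIntegrand]
  rw [h1] at hFTC
  linarith

/-- The point probabilities of the mixture of the laws `NB(r, U ^ (1 / a))`, with `U` uniform
on `(0, 1)`. -/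
noncomputable def mixProb (a r : ℝ) (k : ℕ) : ℝ :=
  ∫ u in (0 : ℝ)..1, nbProb r (u ^ (1 / a)) k

theorem mixProb_eq (a r : ℝ) (k : ℕ) :
    mixProb a r k = Real.Gamma (r + k) / (k.factorial * Real.Gamma r) *
      ∫ u in (0 : ℝ)..1, mixIntegrand a r k u := by
  rw [mixProb, ← intervalIntegral.integral_const_mul]
  simp only [nbProb, mixIntegrand, mul_assoc]

theorem mixProb_zero {a r : ℝ} (ha : 0 < a) (hr : 0 < r) : mixProb a r 0 = a / (a + r) := by
  have := (Real.Gamma_pos_of_pos hr).ne'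
  rw [mixProb_eq, integral_mixIntegrand_zero ha hr]
  simp [this]

theorem mixProb_succ {a r : ℝ} (ha : 0 < a) (hr : 0 < r) (k : ℕ) :
    (a + r + (k + 1)) * mixProb a r (k + 1) = (r + k) * mixProb a r k := by
  have h1 := (Real.Gamma_pos_of_pos hr).ne'
  have h2 : r + k ≠ 0 := by positivity
  rw [mixProb_eq, mixProb_eq, mul_left_comm, integral_mixIntegrand_succ ha hr k, Nat.cast_succ,
    ← add_assoc, Real.Gamma_add_one h2, Nat.factorial_succ]
  push_cast
  field_simp

theorem mixProb_nonneg {a r : ℝ} (ha : 0 < a) (hr : 0 < r) (k : ℕ) : 0 ≤ mixProb a r k := by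
  induction k with
  | zero => rw [mixProb_zero ha hr]; positivity
  | succ k ih =>
    have h := mixProb_succ ha hr k
    have h1 : 0 ≤ (r + k) * mixProb a r k := by positivity
    rw [← h] at h1
    exact nonneg_of_mul_nonneg_right h1 (by positivity)

/-- The point probabilities are of order `k ^ (-1 - a)`, which is `O(k ^ (-2))` for `a ≥ 1`: the
product on the left is nonincreasing in `k`. -/
theorem mixProb_mul_le {a r : ℝ} (ha : 1 ≤ a) (hr : 0 < r) (k : ℕ) :
    mixProb a r k * ((r + k) * (r + k + 1)) ≤ r * (r + 1) := by
  have ha0 : 0 < a := by linarith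
  induction k with
  | zero =>
    rw [mixProb_zero ha0 hr, Nat.cast_zero, add_zero]
    refine mul_le_of_le_one_left (by positivity) ?_
    rw [div_le_one (by positivity)]
    linarith
  | succ k ih =>
    refine le_trans ?_ ih
    have h := mixProb_succ ha0 hr k
    have h0 := mixProb_nonneg ha0 hr (k + 1)
    push_cast
    calc mixProb a r (k + 1) * ((r + (k + 1)) * (r + (k + 1) + 1))
        ≤ mixProb a r (k + 1) * ((a + r + (k + 1)) * (r + (k + 1))) := by
          refine mul_le_mul_of_nonneg_left ?_ h0
          have : 0 ≤ r + (k + 1) := by positivity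
          nlinarith
      _ = ((a + r + (k + 1)) * mixProb a r (k + 1)) * (r + (k + 1)) := by ring
      _ = mixProb a r k * ((r + k) * (r + k + 1)) := by rw [h]; ring

theorem sum_mixProb {a r : ℝ} (ha : 0 < a) (hr : 0 < r) (M : ℕ) :
    ∑ k ∈ Finset.range (M + 1), mixProb a r k = 1 - (r + M) * mixProb a r M / a := by
  induction M with
  | zero =>
    rw [Finset.sum_range_one, mixProb_zero ha hr]
    simp only [Nat.cast_zero, add_zero]
    field_simp
    ring
  | succ M ih =>
    rw [Finset.sum_range_succ, ih, ← mixProb_succ ha hr M]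
    push_cast
    field_simp
    ring

theorem sum_mixProb_le_one {a r : ℝ} (ha : 0 < a) (hr : 0 < r) (M : ℕ) :
    ∑ k ∈ Finset.range M, mixProb a r k ≤ 1 := by
  cases M with
  | zero => simp
  | succ M =>
    rw [sum_mixProb ha hr]
    have := mixProb_nonneg ha hr M
    have : 0 ≤ (r + M) * mixProb a r M / a := by positivity
    linarith

theorem mul_mixProb_le {a r : ℝ} (ha : 1 ≤ a) (hr : 0 < r) (M : ℕ) :
    (r + M) * mixProb a r M ≤ r * (r + 1) / (M + 1) := by
  rw [le_div_iff₀ (by positivity)]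
  refine le_trans ?_ (mixProb_mul_le ha hr M)
  have := mixProb_nonneg (by linarith : 0 < a) hr M
  calc (r + M) * mixProb a r M * (M + 1)
      ≤ (r + M) * mixProb a r M * (r + M + 1) :=
        mul_le_mul_of_nonneg_left (by linarith) (by positivity)
    _ = _ := by ring

theorem hasSum_mixProb {a r : ℝ} (ha : 1 ≤ a) (hr : 0 < r) : HasSum (mixProb a r) 1 := by
  have ha0 : 0 < a := by linarith
  rw [hasSum_iff_tendsto_nat_of_nonneg (mixProb_nonneg ha0 hr),
    ← Filter.tendsto_add_atTop_iff_nat 1]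
  simp only [sum_mixProb ha0 hr]
  have h : Filter.Tendsto (fun M : ℕ => (r + M) * mixProb a r M / a) Filter.atTop (nhds 0) := by
    refine squeeze_zero (g := fun M : ℕ => r * (r + 1) * (1 / ((M : ℝ) + 1)) / a) (fun M => ?_)
      (fun M => ?_) ?_
    · have := mixProb_nonneg ha0 hr M
      positivity
    · rw [mul_one_div]
      exact div_le_div_of_nonneg_right (mul_mixProb_le ha hr M) ha0.le
    · simpa using ((tendsto_one_div_add_atTop_nhds_zero_nat (𝕜 := ℝ)).const_mul
        (r * (r + 1))).div_const a
  simpa using h.const_sub 1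

theorem measurable_NB (r a : ℝ) : Measurable fun u : ℝ => NB r (u ^ (1 / a)) := by
  refine Measure.measurable_of_measurable_coe _ fun s hs => ?_
  simp only [NB, withDensity_apply _ hs]
  simp only [← lintegral_indicator hs, lintegral_count]
  refine Measurable.tsum fun k => ?_
  by_cases hk : k ∈ s
  · simp only [Set.indicator_of_mem hk, nbProb]
    fun_prop
  · simp [Set.indicator_of_notMem hk]

theorem K_singleton {m : ℕ} (hm : 1 ≤ m) {δ : ℝ} (hδ : -(m : ℝ) < δ) (k : ℕ) :
    K m δ {k} = ENNReal.ofReal (mixProb (2 + δ / m) (m + δ) k) := by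
  have ha : 0 < 2 + δ / m := by linarith [neg_one_lt_div hm hδ]
  have hr : 0 < m + δ := by linarith
  rw [K, Measure.bind_apply (measurableSet_singleton k) (measurable_NB _ _).aemeasurable, mixProb,
    intervalIntegral.integral_of_le zero_le_one, integral_Ioc_eq_integral_Ioo,
    ofReal_integral_eq_lintegral_ofReal]
  · refine lintegral_congr fun u => ?_
    rw [NB, withDensity_apply _ (measurableSet_singleton k), lintegral_singleton,
      Measure.count_singleton, mul_one]
  · refine Continuous.integrableOn_Ioc ?_ |>.mono_set Set.Ioo_subset_Ioc_self
    have := (continuous_mixIntegrand ha hr k).const_mul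
      (Real.Gamma ((m + δ) + k) / (k.factorial * Real.Gamma (m + δ)))
    simpa only [nbProb, mixIntegrand, mul_assoc] using this
  · refine (ae_restrict_iff' measurableSet_Ioo).2 (Filter.Eventually.of_forall fun u hu => ?_)
    have h := mixIntegrand_nonneg (r := m + δ) ha k hu.1.le hu.2.le
    have h1 := Real.Gamma_pos_of_pos hr
    have h2 : 0 < Real.Gamma ((m + δ) + k) := Real.Gamma_pos_of_pos (by positivity)
    simp only [nbProb, Pi.zero_apply, mul_assoc]
    exact mul_nonneg (by positivity) h

theorem isProbabilityMeasure_K {m : ℕ} (hm : 1 ≤ m) {δ : ℝ} (hδ : -(m : ℝ) < δ) :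
    IsProbabilityMeasure (K m δ) := by
  have ha : 1 ≤ 2 + δ / m := by linarith [neg_one_lt_div hm hδ]
  have hr : 0 < m + δ := by linarith
  constructor
  rw [← Measure.tsum_indicator_apply_singleton _ _ MeasurableSet.univ]
  simp only [Set.indicator_univ, K_singleton hm hδ]
  have h := hasSum_mixProb ha hr
  rw [← ENNReal.ofReal_tsum_of_nonneg (mixProb_nonneg (by linarith) hr) h.summable, h.tsum_eq,
    ENNReal.ofReal_one]

/-! ### Birth steps acting on mass functions -/

theorem birthStep_add (w f g : ℕ → ℝ) (x : ℕ) :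
    birthStep w (fun y => f y + g y) x = birthStep w f x + birthStep w g x := by
  cases x <;> simp only [birthStep] <;> ring

theorem birthStep_const_mul (w f : ℕ → ℝ) (b : ℝ) (x : ℕ) :
    birthStep w (fun y => b * f y) x = b * birthStep w f x := by
  cases x <;> simp only [birthStep] <;> ring

theorem birthStep_sub (w f g : ℕ → ℝ) (x : ℕ) :
    birthStep w (fun y => f y - g y) x = birthStep w f x - birthStep w g x := by
  cases x <;> simp only [birthStep] <;> ring

theorem birthStep_sum {ι : Type*} (s : Finset ι) (w : ℕ → ℝ) (f : ι → ℕ → ℝ) (x : ℕ) :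
    birthStep w (fun y => ∑ i ∈ s, f i y) x = ∑ i ∈ s, birthStep w (f i) x := by
  cases x <;> simp only [birthStep, Finset.sum_mul, Finset.sum_add_distrib]

/-- `f` moved one step to the right. -/
def shift (f : ℕ → ℝ) : ℕ → ℝ
  | 0 => 0
  | x + 1 => f x

theorem birthStep_sub_const (w f : ℕ → ℝ) (b : ℝ) (x : ℕ) :
    birthStep (fun y => w y - b) f x = birthStep w f x + b * (f x - shift f x) := by
  cases x <;> simp only [birthStep, shift] <;> ring

theorem sum_abs_sub_shift_le (f : ℕ → ℝ) (M : ℕ) :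
    ∑ x ∈ Finset.range M, |f x - shift f x| ≤ 2 * ∑ x ∈ Finset.range M, |f x| := by
  have h : ∑ x ∈ Finset.range M, |shift f x| ≤ ∑ x ∈ Finset.range M, |f x| := by
    cases M with
    | zero => simp
    | succ M =>
      rw [Finset.sum_range_succ', Finset.sum_range_succ]
      simp only [shift, abs_zero]
      linarith [abs_nonneg (f M)]
  calc _ ≤ ∑ x ∈ Finset.range M, (|f x| + |shift f x|) :=
        Finset.sum_le_sum fun x _ => abs_sub _ _
    _ ≤ _ := by rw [Finset.sum_add_distrib]; linarith

/-- As long as its rates are probabilities, a birth step is a contraction in `ℓ¹`. Only the states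
up to `t` are controlled; mass at `t + 1` enters through a boundary term. -/
theorem sum_abs_birthStep_le {w : ℕ → ℝ} (f : ℕ → ℝ) {t : ℕ} (h0 : ∀ x ≤ t, 0 ≤ w x)
    (h1 : ∀ x ≤ t, w x ≤ 1) :
    ∑ x ∈ Finset.range (t + 2), |birthStep w f x| ≤
      ∑ x ∈ Finset.range (t + 1), |f x| + |f (t + 1)| * |1 - w (t + 1)| := by
  calc ∑ x ∈ Finset.range (t + 2), |birthStep w f x|
      ≤ ∑ x ∈ Finset.range (t + 1), (|f (x + 1)| * |1 - w (x + 1)| + |f x| * |w x|) +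
          |f 0| * |1 - w 0| := by
        rw [Finset.sum_range_succ']
        simp only [birthStep, ← abs_mul]
        gcongr
        exact abs_add_le _ _
    _ = ∑ x ∈ Finset.range (t + 1), (|f x| * |1 - w x| + |f x| * |w x|) +
          |f (t + 1)| * |1 - w (t + 1)| := by
        have h := Finset.sum_range_succ' (fun x => |f x| * |1 - w x|) (t + 1)
        rw [Finset.sum_range_succ] at h
        rw [Finset.sum_add_distrib, Finset.sum_add_distrib]
        linarith
    _ = _ := by
        congr 1
        refine Finset.sum_congr rfl fun x hx => ?_
        have hx' : x ≤ t := Nat.lt_succ_iff.1 (Finset.mem_range.1 hx)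
        rw [abs_of_nonneg (h0 x hx'), abs_of_nonneg (sub_nonneg.2 (h1 x hx'))]
        ring

/-! ### The deviation of the expected degree counts from the limit -/

/-- The unit mass at zero. -/
def unitMass (x : ℕ) : ℝ := if x = 0 then 1 else 0

/-- The probability that the edge out of vertex `t + 1` goes into a given complete block of
in-degree `x`. -/
noncomputable def fullRate (ε : ℝ) (m t x : ℕ) : ℝ := (x + m * (1 + ε)) / totalWeight ε t

/-- The limit law is invariant under a birth step and replenishment at zero, to first order. -/
theorem birthStep_mixProb {a r c : ℝ} (ha : 0 < a) (hr : 0 < r) (x : ℕ) :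
    birthStep (fun y => (y + r) / c) (mixProb a r) x =
      mixProb a r x + a / c * (mixProb a r x - unitMass x) := by
  cases x with
  | zero =>
    have h : (a + r) * mixProb a r 0 = a := by
      rw [mixProb_zero ha hr]
      field_simp
    simp only [birthStep, unitMass, if_true, Nat.cast_zero, zero_add]
    linear_combination (-1 / c) * h
  | succ x =>
    have h := mixProb_succ ha hr x
    simp only [birthStep, unitMass, Nat.succ_ne_zero, if_false]
    push_cast
    linear_combination (-1 / c) * h

theorem birthStep_unitMass (r c : ℝ) (x : ℕ) :
    birthStep (fun y => (y + r) / c) unitMass x =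
      unitMass x - r / c * (unitMass x - shift unitMass x) := by
  rcases x with _ | _ | x <;> simp [birthStep, unitMass, shift]

theorem sum_abs_unitMass_le (M : ℕ) : ∑ x ∈ Finset.range M, |unitMass x| ≤ 1 := by
  have h : ∀ x, |unitMass x| = unitMass x := fun x => by
    unfold unitMass; split_ifs <;> simp
  simp only [h]
  simp only [unitMass, Finset.sum_ite_eq', Finset.mem_range]
  split_ifs <;> simp

/-- The expected number of blocks with in-degree `x` in `G_t^{1,ε}`, among the complete blocks and
the one to which the next vertex belongs. -/
noncomputable def profile {ε : ℝ} (hε : -1 < ε) (m t x : ℕ) : ℝ :=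
  ∑ i ∈ Finset.range (t / m + 1), blockProb hε m i t x

/-- The proportion of the current block that is still missing at time `t`. -/
noncomputable def missing (m t : ℕ) : ℝ := (t / m : ℕ) + 1 - (t : ℝ) / m

theorem missing_nonneg {m : ℕ} (hm : 1 ≤ m) (t : ℕ) : 0 ≤ missing m t := by
  have h : (t : ℝ) / m < (t / m : ℕ) + 1 := by
    rw [div_lt_iff₀ (by positivity)]
    exact_mod_cast Nat.lt_mul_of_div_lt (Nat.lt_succ_self (t / m)) (by omega)
  unfold missing
  linarith

theorem missing_le_one (m t : ℕ) : missing m t ≤ 1 := by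
  have h : ((t / m : ℕ) : ℝ) ≤ (t : ℝ) / m := Nat.cast_div_le
  unfold missing
  linarith

/-- The deviation of the profile from a multiple of the limit law. The unit mass accounts for the
block under construction, so that the total mass is zero. -/
noncomputable def deviation {ε : ℝ} (hε : -1 < ε) (m t x : ℕ) : ℝ :=
  profile hε m t x -
    ((t : ℝ) / m * mixProb (2 + ε) (m * (1 + ε)) x + missing m t * unitMass x)

/-- The rate missing from the block under construction, as compared to a complete block. -/
noncomputable def rateGap (ε : ℝ) (m t : ℕ) : ℝ :=
  (1 + ε) * (m - blockSize m (t / m) t) / totalWeight ε t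

theorem birthStep_profile {ε : ℝ} (hε : -1 < ε) {m : ℕ} (hm : 1 ≤ m) (t x : ℕ) :
    ∑ i ∈ Finset.range (t / m + 1), blockProb hε m i (t + 1) x =
      birthStep (fullRate ε m t) (profile hε m t) x +
        rateGap ε m t * (blockProb hε m (t / m) t x - shift (blockProb hε m (t / m) t) x) := by
  unfold profile
  rw [birthStep_sum, Finset.sum_range_succ, Finset.sum_range_succ, add_assoc]
  congr 1
  · refine Finset.sum_congr rfl fun i hi => ?_
    have h : (i + 1) * m ≤ t :=
      (Nat.mul_le_mul_right m (Finset.mem_range.1 hi)).trans (Nat.div_mul_le_self t m)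
    have hrate : blockRate ε m i t = fullRate ε m t := by
      funext y
      rw [blockRate, fullRate, blockSize_eq hm h, mul_comm]
    rw [blockProb_succ, hrate]
  · have hrate : blockRate ε m (t / m) t = fun y => fullRate ε m t y - rateGap ε m t := by
      funext y
      rw [blockRate, fullRate, rateGap]
      ring
    rw [blockProb_succ, hrate, birthStep_sub_const]

/-- The inhomogeneity in the recursion for the deviation. -/
noncomputable def drift {ε : ℝ} (hε : -1 < ε) (m t x : ℕ) : ℝ :=
  rateGap ε m t * (blockProb hε m (t / m) t x - shift (blockProb hε m (t / m) t) x) -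
    (1 + ε) / (m * totalWeight ε t) * (mixProb (2 + ε) (m * (1 + ε)) x - unitMass x) -
    missing m t * (m * (1 + ε) / totalWeight ε t) * (unitMass x - shift unitMass x)

theorem blockProb_start {ε : ℝ} (hε : -1 < ε) (m i x : ℕ) :
    blockProb hε m i (i * m) x = unitMass x := by
  rw [blockProb, blockLaw_eq_pure hε le_rfl, PMF.pure_apply, unitMass]
  split_ifs <;> simp

theorem deviation_succ {ε : ℝ} (hε : -1 < ε) {m : ℕ} (hm : 1 ≤ m) (t x : ℕ) :
    deviation hε m (t + 1) x =
      birthStep (fullRate ε m t) (deviation hε m t) x + drift hε m t x := by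
  have hm0 : (m : ℝ) ≠ 0 := by positivity
  have hε1 : 0 < 1 + ε := by linarith
  have hc := (totalWeight_pos hε t).ne'
  -- A new block, with no edges, comes into play when the current one is complete.
  have hprof : profile hε m (t + 1) x - missing m (t + 1) * unitMass x =
      ∑ i ∈ Finset.range (t / m + 1), blockProb hε m i (t + 1) x -
        (missing m t - 1 / m) * unitMass x := by
    unfold profile missing
    rw [Nat.succ_div]
    split_ifs with hd
    · have ht : t + 1 = (t / m + 1) * m := by
        rw [← Nat.div_mul_cancel hd, Nat.succ_div_of_dvd hd]
      rw [Finset.sum_range_succ _ (t / m + 1)]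
      have h := blockProb_start hε m (t / m + 1) x
      rw [← ht] at h
      rw [h]
      push_cast
      ring
    · push_cast
      ring
  have hdev : birthStep (fullRate ε m t) (deviation hε m t) x =
      birthStep (fullRate ε m t) (profile hε m t) x -
        ((t : ℝ) / m * birthStep (fullRate ε m t) (mixProb (2 + ε) (m * (1 + ε))) x +
          missing m t * birthStep (fullRate ε m t) unitMass x) := by
    rw [← birthStep_const_mul, ← birthStep_const_mul, ← birthStep_add, ← birthStep_sub]
    rfl
  have h1 : birthStep (fullRate ε m t) (mixProb (2 + ε) (m * (1 + ε))) x = _ :=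
    birthStep_mixProb (by linarith) (by positivity) x
  have h2 : birthStep (fullRate ε m t) unitMass x = _ := birthStep_unitMass _ _ x
  have h3 := birthStep_profile hε hm t x
  rw [hdev, h1, h2, drift, deviation, sub_add_eq_sub_sub_swap, hprof, h3]
  set c := totalWeight ε t with hcdef
  have ht : (t : ℝ) = (c - (1 + ε)) / (2 + ε) := by
    rw [hcdef, totalWeight, eq_div_iff (by linarith)]
    ring
  have ha : 2 + ε ≠ 0 := by linarith
  push_cast
  rw [ht]
  field_simp
  ring

theorem sum_abs_drift_le {ε : ℝ} (hε : -1 < ε) {m : ℕ} (hm : 1 ≤ m) (t M : ℕ) :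
    ∑ x ∈ Finset.range M, |drift hε m t x| ≤ (4 * m + 2) / (t + 1) := by
  have hm1 : (1 : ℝ) ≤ m := by exact_mod_cast hm
  have hε1 : 0 < 1 + ε := by linarith
  have hc := totalWeight_pos hε t
  set p := mixProb (2 + ε) (m * (1 + ε))
  set q := blockProb hε m (t / m) t
  set b := m * (1 + ε) / totalWeight ε t with hb
  have hb0 : 0 ≤ b := by positivity
  have hbt : b ≤ m / (t + 1) := by
    rw [hb, div_le_div_iff₀ hc (by positivity), totalWeight_eq]
    have : (0 : ℝ) ≤ m * t := by positivity
    nlinarith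
  have hgap0 : 0 ≤ rateGap ε m t := by
    have : (blockSize m (t / m) t : ℝ) ≤ m := by exact_mod_cast blockSize_le_size hm _ _
    have : (0 : ℝ) ≤ m - blockSize m (t / m) t := by linarith
    unfold rateGap
    positivity
  have hgap : rateGap ε m t ≤ b := by
    rw [rateGap, hb, mul_comm (m : ℝ)]
    gcongr
    linarith [Nat.cast_nonneg (α := ℝ) (blockSize m (t / m) t)]
  have hd0 : 0 ≤ (1 + ε) / (m * totalWeight ε t) := by positivity
  have hd : (1 + ε) / (m * totalWeight ε t) ≤ 1 / (t + 1) := by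
    rw [div_le_div_iff₀ (by positivity) (by positivity), totalWeight_eq]
    have : (1 + ε) * (t + 1) ≤ t + (1 + ε) * (t + 1) := by linarith [Nat.cast_nonneg (α := ℝ) t]
    have h2 : 0 ≤ t + (1 + ε) * (t + 1) := by positivity
    nlinarith
  have hq : ∑ x ∈ Finset.range M, |q x - shift q x| ≤ 2 := by
    refine (sum_abs_sub_shift_le q M).trans ?_
    simp only [abs_of_nonneg (blockProb_nonneg hε m (t / m) t _), q]
    linarith [sum_blockProb_le_one hε m (t / m) t M]
  have hu : ∑ x ∈ Finset.range M, |unitMass x - shift unitMass x| ≤ 2 :=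
    (sum_abs_sub_shift_le unitMass M).trans (by linarith [sum_abs_unitMass_le M])
  have hp : ∑ x ∈ Finset.range M, |p x - unitMass x| ≤ 2 := by
    calc _ ≤ ∑ x ∈ Finset.range M, (|p x| + |unitMass x|) :=
          Finset.sum_le_sum fun x _ => abs_sub _ _
      _ ≤ 2 := by
          have hr : 0 < m * (1 + ε) := by positivity
          rw [Finset.sum_add_distrib]
          simp only [abs_of_nonneg (mixProb_nonneg (by linarith : 0 < 2 + ε) hr _), p]
          linarith [sum_abs_unitMass_le M, sum_mixProb_le_one (by linarith : 0 < 2 + ε) hr M]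
  have hmiss : missing m t * b ≤ b := mul_le_of_le_one_left hb0 (missing_le_one m t)
  have hmiss0 : 0 ≤ missing m t * b := mul_nonneg (missing_nonneg hm t) hb0
  calc ∑ x ∈ Finset.range M, |drift hε m t x|
      ≤ ∑ x ∈ Finset.range M, (b * |q x - shift q x| + 1 / (t + 1) * |p x - unitMass x| +
          b * |unitMass x - shift unitMass x|) := by
        refine Finset.sum_le_sum fun x _ => ?_
        unfold drift
        refine (abs_sub _ _).trans (add_le_add ((abs_sub _ _).trans (add_le_add ?_ ?_)) ?_)
        · rw [abs_mul, abs_of_nonneg hgap0]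
          gcongr
        · rw [abs_mul, abs_of_nonneg hd0]
          gcongr
        · rw [abs_mul, abs_of_nonneg hmiss0]
          gcongr
    _ ≤ b * 2 + 1 / (t + 1) * 2 + b * 2 := by
        rw [Finset.sum_add_distrib, Finset.sum_add_distrib, ← Finset.mul_sum, ← Finset.mul_sum,
          ← Finset.mul_sum]
        gcongr
    _ ≤ m / (t + 1) * 2 + 1 / (t + 1) * 2 + m / (t + 1) * 2 := by gcongr
    _ = _ := by ring

/-- The mass that the limit law places just beyond the range of the in-degrees. -/
theorem abs_deviation_boundary_le {ε : ℝ} (hε : -1 < ε) {m : ℕ} (hm : 1 ≤ m) (t : ℕ) :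
    |deviation hε m t (t + 1)| * |1 - fullRate ε m t (t + 1)| ≤
      m * (1 + ε) * (m * (1 + ε) + 1) * (1 + (1 + m * (1 + ε)) / (1 + ε)) / (t + 1) := by
  have hm1 : (1 : ℝ) ≤ m := by exact_mod_cast hm
  have hε1 : 0 < 1 + ε := by linarith
  have hc := totalWeight_pos hε t
  set r := m * (1 + ε) with hr
  have hr0 : 0 < r := by positivity
  set p := mixProb (2 + ε) r
  have hp0 : 0 ≤ p (t + 1) := mixProb_nonneg (by linarith) hr0 _
  have h1 : |deviation hε m t (t + 1)| ≤ r * (r + 1) / (t + 1) := by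
    have h : deviation hε m t (t + 1) = -((t : ℝ) / m * p (t + 1)) := by
      simp [deviation, profile, blockProb_eq_zero_of_lt hε m _ (Nat.lt_succ_self t), unitMass, p,
        hr]
    rw [h, abs_neg, abs_of_nonneg (by positivity)]
    calc (t : ℝ) / m * p (t + 1) ≤ (r + (t + 1 : ℕ)) * p (t + 1) := by
          gcongr
          push_cast
          linarith [div_le_self (Nat.cast_nonneg (α := ℝ) t) hm1]
      _ ≤ r * (r + 1) / ((t + 1 : ℕ) + 1) := mul_mixProb_le (by linarith) hr0 _
      _ ≤ _ := by
          gcongr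
          linarith
  have h2 : |1 - fullRate ε m t (t + 1)| ≤ 1 + (1 + r) / (1 + ε) := by
    have h0 : 0 ≤ fullRate ε m t (t + 1) := by unfold fullRate; positivity
    have h : fullRate ε m t (t + 1) ≤ (1 + r) / (1 + ε) := by
      rw [fullRate, div_le_div_iff₀ hc hε1, totalWeight_eq]
      have : 0 ≤ r * t * (1 + ε) := by positivity
      have : 0 ≤ (1 + r) * t := by positivity
      push_cast
      nlinarith
    refine (abs_sub _ _).trans ?_
    rw [abs_one, abs_of_nonneg h0]
    linarith
  calc _ ≤ r * (r + 1) / (t + 1) * (1 + (1 + r) / (1 + ε)) := by gcongr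
    _ = _ := by ring

/-- The `ℓ¹`-norm of the deviation, up to the largest possible in-degree. -/
noncomputable def deviationNorm {ε : ℝ} (hε : -1 < ε) (m t : ℕ) : ℝ :=
  ∑ x ∈ Finset.range (t + 1), |deviation hε m t x|

theorem deviationNorm_succ_le {ε : ℝ} (hε : -1 < ε) {m : ℕ} (hm : 1 ≤ m) :
    ∃ B : ℝ, 0 ≤ B ∧ ∀ t, m ≤ t →
      deviationNorm hε m (t + 1) ≤ deviationNorm hε m t + B / (t + 1) := by
  have hε1 : 0 < 1 + ε := by linarith
  refine ⟨m * (1 + ε) * (m * (1 + ε) + 1) * (1 + (1 + m * (1 + ε)) / (1 + ε)) + (4 * m + 2),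
    by positivity, fun t ht => ?_⟩
  have hc := totalWeight_pos hε t
  unfold deviationNorm
  calc _ ≤ ∑ x ∈ Finset.range (t + 2), (|birthStep (fullRate ε m t) (deviation hε m t) x| +
        |drift hε m t x|) := by
        refine Finset.sum_le_sum fun x _ => ?_
        rw [deviation_succ hε hm]
        exact abs_add_le _ _
    _ ≤ _ := by
        rw [Finset.sum_add_distrib, add_div, ← add_assoc]
        refine add_le_add ((sum_abs_birthStep_le _ (fun x _ => ?_) fun x hx => ?_).trans
          (add_le_add_right (abs_deviation_boundary_le hε hm t) _)) (sum_abs_drift_le hε hm t _)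
        · unfold fullRate
          positivity
        · have h1 : (x : ℝ) ≤ t := by exact_mod_cast hx
          have h2 : (m : ℝ) ≤ t := by exact_mod_cast ht
          rw [fullRate, div_le_one hc, totalWeight_eq]
          nlinarith

theorem deviationNorm_le {ε : ℝ} (hε : -1 < ε) {m : ℕ} (hm : 1 ≤ m) :
    ∃ A B : ℝ, 0 ≤ A ∧ 0 ≤ B ∧ ∀ t, m ≤ t → deviationNorm hε m t ≤ A + B * Real.log t := by
  obtain ⟨B, hB, h⟩ := deviationNorm_succ_le hε hm
  refine ⟨deviationNorm hε m m, B, Finset.sum_nonneg fun _ _ => abs_nonneg _, hB, fun t ht => ?_⟩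
  induction t, ht using Nat.le_induction with
  | base => exact le_add_of_nonneg_right (mul_nonneg hB (Real.log_natCast_nonneg m))
  | succ t ht ih =>
    have ht0 : (0 : ℝ) < t := by exact_mod_cast (by omega : 0 < t)
    have hlog : 1 / ((t : ℝ) + 1) ≤ Real.log (t + 1) - Real.log t := by
      have h1 := Real.one_sub_inv_le_log_of_pos (x := (t + 1) / (t : ℝ)) (by positivity)
      rw [Real.log_div (by positivity) ht0.ne'] at h1
      refine le_trans (le_of_eq ?_) h1
      field_simp
      ring
    have h2 := mul_le_mul_of_nonneg_left hlog hB
    rw [mul_one_div] at h2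
    push_cast
    linarith [h t ht]

/-! ### Total variation distance -/

/-- Total variation distance of two laws, the first of which is supported on `{0, …, M}`. -/
theorem dTV_le {μ ν : Measure ℕ} [IsProbabilityMeasure μ] [IsProbabilityMeasure ν] (M : ℕ)
    (hμ : μ.real {x | M < x} = 0) :
    dTV μ ν ≤ 2 * ∑ x ∈ Finset.range (M + 1), |μ.real {x} - ν.real {x}| := by
  set s := Finset.range (M + 1)
  set S := ∑ x ∈ s, |μ.real {x} - ν.real {x}|
  have hS : 0 ≤ S := Finset.sum_nonneg fun _ _ => abs_nonneg _
  have hfin : ∀ t ⊆ s, |μ.real t - ν.real t| ≤ S := fun t ht => by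
    rw [← sum_measureReal_singleton (μ := μ) t, ← sum_measureReal_singleton (μ := ν) t,
      ← Finset.sum_sub_distrib]
    exact (Finset.abs_sum_le_sum_abs _ _).trans
      (Finset.sum_le_sum_of_subset_of_nonneg ht fun _ _ _ => abs_nonneg _)
  have hset : {x | M < x} = (s : Set ℕ)ᶜ := by
    ext x
    simp [s]
  have hν : ν.real {x | M < x} ≤ S := by
    have h := (abs_le.1 (hfin s subset_rfl)).2
    rw [hset, probReal_compl_eq_one_sub s.measurableSet] at hμ ⊢
    linarith
  refine ciSup_le fun A => ?_
  classical
  have hsplit : ∀ (ρ : Measure ℕ) [IsProbabilityMeasure ρ],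
      ρ.real A = ρ.real (s.filter (· ∈ A)) + ρ.real (A ∩ {x | M < x}) := fun ρ _ => by
    rw [← measureReal_inter_add_sdiff (s := A) (t := (s : Set ℕ)) s.measurableSet, hset,
      Set.sdiff_eq]
    congr 2
    ext x
    simp [and_comm]
  have h1 : μ.real (A ∩ {x | M < x}) = 0 :=
    le_antisymm ((measureReal_mono Set.inter_subset_right).trans hμ.le) measureReal_nonneg
  have h2 : ν.real (A ∩ {x | M < x}) ≤ S := (measureReal_mono Set.inter_subset_right).trans hν
  have h2' : 0 ≤ ν.real (A ∩ {x | M < x}) := measureReal_nonneg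
  have h3 := abs_le.1 (hfin (s.filter (· ∈ A)) (Finset.filter_subset _ _))
  rw [hsplit μ, hsplit ν, h1, abs_le]
  constructor <;> linarith [h3.1, h3.2]

/-- At the times `n * m`, the deviation is that of the law of `W_n` from its limit. -/
theorem deviation_mul {m : ℕ} (hm : 1 ≤ m) {δ : ℝ} (hδ : -(m : ℝ) < δ) (n : ℕ) [NeZero n]
    (x : ℕ) :
    deviation (neg_one_lt_div hm hδ) m (n * m) x =
      n * ((inDegreeLaw hm hδ n).toMeasure.real {x} - (K m δ).real {x}) := by
  have hm0 : (m : ℝ) ≠ 0 := by positivity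
  have hn0 : (n : ℝ) ≠ 0 := by exact_mod_cast NeZero.ne n
  have hr : m * (1 + δ / m) = m + δ := by field_simp
  rw [measureReal_def, measureReal_def,
    PMF.toMeasure_apply_singleton _ _ (measurableSet_singleton x), toReal_inDegreeLaw,
    K_singleton hm hδ, ENNReal.toReal_ofReal
      (mixProb_nonneg (by linarith [neg_one_lt_div hm hδ]) (by linarith) x),
    deviation, profile, missing, hr, Nat.mul_div_cancel _ (by omega), Finset.sum_range_succ,
    blockProb_start]
  push_cast
  field_simp
  ring

end PrefAttach

theorem mainTheorem1 {m : ℕ} (hm : 1 ≤ m) {δ : ℝ} (hδ : -(m : ℝ) < δ) :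
    ∃ C : ℝ, ∀ (n : ℕ) [NeZero n], 2 ≤ n →
      PrefAttach.dTV (PrefAttach.inDegreeLaw hm hδ n).toMeasure (PrefAttach.K m δ) ≤
        C * (Real.log n / n) := by
  obtain ⟨A, B, hA, hB, h⟩ := PrefAttach.deviationNorm_le (PrefAttach.neg_one_lt_div hm hδ) hm
  have hlm := Real.log_natCast_nonneg m
  have hl2 : 0 < Real.log 2 := Real.log_pos one_lt_two
  refine ⟨2 * ((A + B * Real.log m) / Real.log 2 + B), fun n _ hn => ?_⟩
  have hn0 : (0 : ℝ) < n := by positivity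
  have := PrefAttach.isProbabilityMeasure_K hm hδ
  have hzero : (PrefAttach.inDegreeLaw hm hδ n).toMeasure.real {x | n * m < x} = 0 := by
    rw [measureReal_eq_zero_iff, PMF.toMeasure_apply_eq_zero_iff _
      (MeasurableSet.of_discrete), Set.disjoint_right]
    intro x hx
    have hx0 := PrefAttach.toReal_inDegreeLaw hm hδ n x
    simp only [PrefAttach.blockProb_eq_zero_of_lt _ m _ hx, Finset.sum_const_zero, zero_div] at hx0
    rw [PMF.mem_support_iff, not_not]
    exact (ENNReal.toReal_eq_zero_iff _).1 hx0 |>.resolve_right (PMF.apply_ne_top _ _)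
  have hsum : ∑ x ∈ Finset.range (n * m + 1),
      |(PrefAttach.inDegreeLaw hm hδ n).toMeasure.real {x} - (PrefAttach.K m δ).real {x}| =
        PrefAttach.deviationNorm (PrefAttach.neg_one_lt_div hm hδ) m (n * m) / n := by
    simp only [PrefAttach.deviationNorm, PrefAttach.deviation_mul hm hδ n, abs_mul,
      abs_of_pos hn0, ← Finset.mul_sum]
    field_simp
  have hlog : Real.log 2 ≤ Real.log n := Real.log_le_log two_pos (by exact_mod_cast hn)
  have hdev := h (n * m) (Nat.le_mul_of_pos_left m (by omega))
  rw [Nat.cast_mul, Real.log_mul hn0.ne' (by positivity)] at hdev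
  have hbound : A + B * (Real.log n + Real.log m) ≤
      ((A + B * Real.log m) / Real.log 2 + B) * Real.log n := by
    have h0 : 0 ≤ (A + B * Real.log m) / Real.log 2 := by positivity
    have h1 := mul_le_mul_of_nonneg_left hlog h0
    rw [div_mul_cancel₀ _ hl2.ne'] at h1
    linarith
  refine (PrefAttach.dTV_le (n * m) hzero).trans ?_
  rw [hsum]
  calc _ ≤ 2 * (((A + B * Real.log m) / Real.log 2 + B) * Real.log n / n) := by
        gcongr
        exact hdev.trans hbound
    _ = _ := by ring
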